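/- Let $A\in\mathbb R^{n\times n}$, $B\in\mathbb R^{n\times m}$, $S\in\mathbb R^{m\times n}$ and let $Q\in\mathbb R^{n\times n}$, $R\in\mathbb R^{m\times m}$ be symmetric (no definiteness is assumed). Put $H=\begin{pmatrix}Q&S^\top\\S&R\end{pmatrix}$ and $\ell(x,u)=\begin{pmatrix}x\\u\end{pmatrix}^{\!\top}H\begin{pmatrix}x\\u\end{pmatrix}$. For a symmetric matrix $P^{\mathrm f}\in\mathbb R^{n\times n}$ and $x_0\in\mathbb R^n$ consider the infinite-horizon LQR problem $$V(x_0)=\min_{u_0,u_1,\ldots}\ \lim_{N\to\infty}\Big(\sum_{k=0}^{N-1}\ell(x_k,u_k)+x_N^\top P^{\mathrm f}x_N\Big)\quad\text{s.t.}\quad x_{k+1}=Ax_k+Bu_k,$$ where the minimum is over all input sequences for which the limit exists in $[-\infty,\infty]$. A solution of the corresponding discrete algebraic Riccati equation (DARE) is a symmetric matrix $P$ such that $R+B^\top PB$ is invertible and $$P=Q+A^\top PA-(S^\top+A^\top PB)K_P,\qquad K_P=(R+B^\top PB)^{-1}(S+B^\top PA).$$ It is called stabilizing (antistabilizing) if every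 complex eigenvalue $\mu$ of $A-BK_P$ satisfies $|\mu|<1$ ($|\mu|>1$). Assume that $(A,B)$ is stabilizable, i.e. all eigenvalues of $A-BK$ lie in the open unit disc for some $K\in\mathbb R^{m\times n}$; that the problem is strictly $(x,u)$-pre-dissipative, i.e. there is a symmetric $\Lambda\in\mathbb R^{n\times n}$ with $$\begin{pmatrix}Q+\Lambda-A^\top\Lambda A& S^\top-A^\top\Lambda B\\ S-B^\top\Lambda A&R-B^\top\Lambda B\end{pmatrix}\succ0;$$ and that the DARE has an antistabilizing solution $P_{\mathrm a}$. Theorem. For every symmetric $E\succ0$, the infinite-horizon problem with terminal cost matrix $P^{\mathrm f}=P_{\mathrm a}+E$ is solved by the stabilizing solution of the DARE. That is, the DARE has exactly one stabilizing solution $P_{\mathrm s}$, and, with $K_{\mathrm s}=K_{P_{\mathrm s}}$, for every $x_0\in\mathbb R^n$: 1. the minimum is attained and $V(x_0)=x_0^\top P_{\mathrm s}x_0$; 2. an input sequence $u$ with trajectory $x$ is optimal if and only if $u_k=-K_{\mathrm s}x_k$ for all $k\ge0$; 3. for every input sequence (also if the limit does not exist), $\liminf_{N\to\infty}\big(\sum_{k=0}^{N-1}\ell(x_k,u_k)+x_N^\top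 P^{\mathrm f}x_N\big)\ge x_0^\top P_{\mathrm s}x_0$. In particular, the origin is an asymptotically stable equilibrium of the optimally controlled system $x_{k+1}=(A-BK_{\mathrm s})x_k$. -/

import Mathlib

open Matrix Filter Topology

noncomputable section

/-- Data of a linear-quadratic problem with state space `ℝⁿ` and input space `ℝᵐ`:
dynamics `x⁺ = A x + B u`, and the blocks `Q`, `S`, `R` of the symmetric stage cost matrix
`[[Q, Sᵀ], [S, R]]`. No definiteness is required. -/
structure LQProblem (n m : ℕ) where
  A : Matrix (Fin n) (Fin n) ℝ
  B : Matrix (Fin n) (Fin m) ℝ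
  Q : Matrix (Fin n) (Fin n) ℝ
  S : Matrix (Fin m) (Fin n) ℝ
  R : Matrix (Fin m) (Fin m) ℝ
  Q_symm : Q.IsSymm
  R_symm : R.IsSymm

/-- All complex eigenvalues of the real matrix `M` satisfy `|μ| < 1`. -/
def IsSchurStable {n : ℕ} (M : Matrix (Fin n) (Fin n) ℝ) : Prop :=
  ∀ μ ∈ spectrum ℂ (M.map (algebraMap ℝ ℂ)), ‖μ‖ < 1

/-- All complex eigenvalues of the real matrix `M` satisfy `|μ| > 1`. -/
def IsAntistable {n : ℕ} (M : Matrix (Fin n) (Fin n) ℝ) : Prop :=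
  ∀ μ ∈ spectrum ℂ (M.map (algebraMap ℝ ℂ)), 1 < ‖μ‖

/-- `x₀` is an asymptotically stable equilibrium of `x_{k+1} = f (x_k)`: it is a fixed point,
it is Lyapunov stable, and it attracts all trajectories starting close to it. -/
def IsAsymptoticallyStableEquilibrium {X : Type*} [TopologicalSpace X] (f : X → X) (x₀ : X) :
    Prop :=
  f x₀ = x₀ ∧
  (∀ U ∈ 𝓝 x₀, ∃ V ∈ 𝓝 x₀, ∀ x ∈ V, ∀ k : ℕ, f^[k] x ∈ U) ∧
  (∀ᶠ x in 𝓝 x₀, Tendsto (fun k : ℕ => f^[k] x) atTop (𝓝 x₀))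

namespace LQProblem

variable {n m : ℕ} (p : LQProblem n m)

/-- The stage cost matrix `H`. -/
def H : Matrix (Fin n ⊕ Fin m) (Fin n ⊕ Fin m) ℝ :=
  fromBlocks p.Q p.Sᵀ p.S p.R

/-- The stage cost `ℓ(x,u) = [x; u]ᵀ H [x; u]`. -/
def stageCost (x : Fin n → ℝ) (u : Fin m → ℝ) : ℝ :=
  Sum.elim x u ⬝ᵥ (p.H *ᵥ Sum.elim x u)

/-- The rotated stage cost matrix `H_Λ`. -/
def rotatedH (L : Matrix (Fin n) (Fin n) ℝ) : Matrix (Fin n ⊕ Fin m) (Fin n ⊕ Fin m) ℝ :=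
  fromBlocks (p.Q + L - p.Aᵀ * L * p.A) (p.Sᵀ - p.Aᵀ * L * p.B)
    (p.S - p.Bᵀ * L * p.A) (p.R - p.Bᵀ * L * p.B)

/-- (Quadratic) strict `(x,u)`-pre-dissipativity: for some quadratic storage function
`λ(x) = xᵀ Λ x`, not necessarily bounded from below, the rotated stage cost is positive
definite. -/
def IsStrictlyPreDissipative : Prop :=
  ∃ L : Matrix (Fin n) (Fin n) ℝ, L.IsSymm ∧ (p.rotatedH L).PosDef

/-- The pair `(A, B)` is stabilizable. -/
def IsStabilizable : Prop :=
  ∃ K : Matrix (Fin m) (Fin n) ℝ, IsSchurStable (p.A - p.B * K)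

/-- The feedback matrix `K = (R + Bᵀ P B)⁻¹ (S + Bᵀ P A)` associated with `P`. -/
def gain (P : Matrix (Fin n) (Fin n) ℝ) : Matrix (Fin m) (Fin n) ℝ :=
  (p.R + p.Bᵀ * P * p.B)⁻¹ * (p.S + p.Bᵀ * P * p.A)

/-- `P` is a (symmetric) solution of the discrete algebraic Riccati equation; the inverse that
occurs in the equation has to exist. -/
structure IsDARESolution (P : Matrix (Fin n) (Fin n) ℝ) : Prop where
  symm : P.IsSymm
  isUnit : IsUnit (p.R + p.Bᵀ * P * p.B)
  eq : P = p.Q + p.Aᵀ * P * p.A - (p.Sᵀ + p.Aᵀ * P * p.B) * p.gain P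

/-- `P` is a stabilizing solution of the DARE. -/
def IsStabilizingSolution (P : Matrix (Fin n) (Fin n) ℝ) : Prop :=
  p.IsDARESolution P ∧ IsSchurStable (p.A - p.B * p.gain P)

/-- `P` is an antistabilizing solution of the DARE. -/
def IsAntistabilizingSolution (P : Matrix (Fin n) (Fin n) ℝ) : Prop :=
  p.IsDARESolution P ∧ IsAntistable (p.A - p.B * p.gain P)

/-- The state trajectory `x_{k+1} = A x_k + B u_k` with initial value `x₀`. -/
def state (x₀ : Fin n → ℝ) (u : ℕ → Fin m → ℝ) : ℕ → Fin n → ℝ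
  | 0 => x₀
  | k + 1 => p.A *ᵥ state x₀ u k + p.B *ᵥ u k

/-- The cost over the horizon `N` with terminal cost matrix `Pf`:
`∑_{k<N} ℓ(x_k, u_k) + x_Nᵀ Pf x_N`. -/
def horizonCost (Pf : Matrix (Fin n) (Fin n) ℝ) (x₀ : Fin n → ℝ) (u : ℕ → Fin m → ℝ)
    (N : ℕ) : ℝ :=
  ∑ k ∈ Finset.range N, p.stageCost (p.state x₀ u k) (u k)
    + p.state x₀ u N ⬝ᵥ (Pf *ᵥ p.state x₀ u N)

/-- The infinite-horizon cost of the input sequence `u`, i.e. the limit of the costs over the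
horizons `N → ∞`, exists in `[-∞, ∞]` and equals `c`. -/
def HasCost (Pf : Matrix (Fin n) (Fin n) ℝ) (x₀ : Fin n → ℝ) (u : ℕ → Fin m → ℝ)
    (c : EReal) : Prop :=
  Tendsto (fun N : ℕ => (p.horizonCost Pf x₀ u N : EReal)) atTop (𝓝 c)

/-- `c` is the optimal value of the infinite-horizon problem with initial value `x₀`
(in particular, the minimum is attained). -/
def IsOptimalValue (Pf : Matrix (Fin n) (Fin n) ℝ) (x₀ : Fin n → ℝ) (c : EReal) : Prop :=
  IsLeast {c' : EReal | ∃ u : ℕ → Fin m → ℝ, p.HasCost Pf x₀ u c'} c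

/-- The input sequence `u` is optimal for the infinite-horizon problem with initial value `x₀`. -/
def IsOptimalInput (Pf : Matrix (Fin n) (Fin n) ℝ) (x₀ : Fin n → ℝ) (u : ℕ → Fin m → ℝ) :
    Prop :=
  ∃ c : EReal, p.HasCost Pf x₀ u c ∧ p.IsOptimalValue Pf x₀ c

end LQProblem

end

noncomputable section

/-! ### Powers of Schur stable matrices -/

section PowerStability

open scoped Matrix.Norms.Operator NNReal ENNReal

/-! Write Λ for the storage matrix (`L` below) and W_P = R + BᵀPB. Completing the square for a DARE
solution P shows that the cost with terminal matrix P is x₀ᵀPx₀ plus the sum of the W_P-squares of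
u_k + K_P x_k (`IsDARESolution.horizonCost_eq`), and it ties the rotated cost to the change of P + Λ
(`IsDARESolution.rotatedCost_add`). As the rotated cost is positive, running the closed loop
forwards gives P_s + Λ ⪰ 0 and running it backwards gives P_a + Λ ≺ 0; in both cases W_P ≻ 0.

The crux is that inputs of finite cost must be shown to drive the state to 0
(`IsAntistabilizingSolution.tendsto_state`). With terminal matrix P_a + E the cost is x₀ᵀP_a x₀ plus
nonnegative squares plus x_NᵀEx_N. A bound along a subsequence of horizons therefore bounds the
squares and x_N there, hence the total rotated cost, so x_N → 0. The terminal matrix may then be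
exchanged for P_s with vanishing error, and the squares for P_s give both the lower bound and the
characterization of optimal inputs.

P_s itself is the limit of value iteration started at −Λ, which is monotone, and bounded by
stabilizability (`exists_isStabilizingSolution`). -/

lemma norm_map_algebraMap_complex {n : ℕ} (M : Matrix (Fin n) (Fin n) ℝ) :
    ‖M.map (algebraMap ℝ ℂ)‖ = ‖M‖ := by
  simp [Matrix.linfty_opNorm_def]

/-- The powers of a Schur stable matrix are summable in norm. -/
lemma IsSchurStable.summable_norm_pow {n : ℕ} {M : Matrix (Fin n) (Fin n) ℝ}
    (hM : IsSchurStable M) : Summable fun k : ℕ => ‖M ^ k‖ := by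
  rcases Nat.eq_zero_or_pos n with rfl | hn
  · have h : ∀ k : ℕ, ‖M ^ k‖ = 0 := fun k => by
      rw [Subsingleton.elim (M ^ k) 0, norm_zero]
    simpa only [h] using summable_zero
  have : Nonempty (Fin n) := ⟨⟨0, hn⟩⟩
  set a : Matrix (Fin n) (Fin n) ℂ := M.map (algebraMap ℝ ℂ) with ha
  -- The norm is the maximal absolute row sum, so Gelfand's formula over ℂ controls the real powers.
  have hpow : ∀ k : ℕ, ‖a ^ k‖ = ‖M ^ k‖ := fun k => by
    rw [← norm_map_algebraMap_complex (M ^ k)]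
    exact congrArg norm (map_pow (algebraMap ℝ ℂ).mapMatrix M k).symm
  have hrad : spectralRadius ℂ a < ((1 : ℝ≥0) : ℝ≥0∞) :=
    spectrum.spectralRadius_lt_of_forall_lt a fun z hz => by
      have := hM z hz
      exact_mod_cast this
  obtain ⟨r, hr, hr1⟩ := ENNReal.lt_iff_exists_nnreal_btwn.mp hrad
  have hr1' : (r : ℝ) < 1 := by exact_mod_cast hr1
  have hev : ∀ᶠ k : ℕ in atTop, ‖M ^ k‖ ≤ (r : ℝ) ^ k := by
    filter_upwards [(spectrum.pow_nnnorm_pow_one_div_tendsto_nhds_spectralRadius a).eventually_lt_const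
      hr, eventually_gt_atTop 0] with k hk hk0
    have hk0' : (0 : ℝ) < k := by exact_mod_cast hk0
    have h1 := ENNReal.rpow_le_rpow hk.le hk0'.le
    rw [← ENNReal.rpow_mul, one_div_mul_cancel hk0'.ne', ENNReal.rpow_one,
      ENNReal.rpow_natCast] at h1
    rw [← hpow]
    exact_mod_cast h1
  refine (summable_geometric_of_lt_one r.coe_nonneg hr1').of_norm_bounded_eventually_nat ?_
  simpa using hev

lemma IsSchurStable.tendsto_pow_mulVec {n : ℕ} {M : Matrix (Fin n) (Fin n) ℝ}
    (hM : IsSchurStable M) (x : Fin n → ℝ) :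
    Tendsto (fun k : ℕ => M ^ k *ᵥ x) atTop (𝓝 0) := by
  refine squeeze_zero_norm (fun k => Matrix.linfty_opNorm_mulVec (M ^ k) x) ?_
  simpa using hM.summable_norm_pow.tendsto_atTop_zero.mul_const ‖x‖

lemma IsSchurStable.exists_sum_sq_norm_le {n : ℕ} {M : Matrix (Fin n) (Fin n) ℝ}
    (hM : IsSchurStable M) :
    ∃ C : ℝ, ∀ (x : Fin n → ℝ) (N : ℕ), ∑ k ∈ Finset.range N, ‖M ^ k *ᵥ x‖ ^ 2 ≤ C * ‖x‖ ^ 2 := by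
  have hs := hM.summable_norm_pow
  set T := ∑' k : ℕ, ‖M ^ k‖ with hT
  have hT0 : 0 ≤ T := tsum_nonneg fun k => norm_nonneg _
  refine ⟨T * T, fun x N => ?_⟩
  calc ∑ k ∈ Finset.range N, ‖M ^ k *ᵥ x‖ ^ 2
      ≤ ∑ k ∈ Finset.range N, T * ‖M ^ k‖ * ‖x‖ ^ 2 := by
        refine Finset.sum_le_sum fun k _ => ?_
        have h1 := Matrix.linfty_opNorm_mulVec (M ^ k) x
        have h2 : ‖M ^ k‖ ≤ T := hs.le_tsum k fun j _ => norm_nonneg _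
        calc ‖M ^ k *ᵥ x‖ ^ 2 ≤ (‖M ^ k‖ * ‖x‖) ^ 2 := by gcongr
          _ = ‖M ^ k‖ * ‖M ^ k‖ * ‖x‖ ^ 2 := by ring
          _ ≤ T * ‖M ^ k‖ * ‖x‖ ^ 2 := by gcongr
    _ = T * (∑ k ∈ Finset.range N, ‖M ^ k‖) * ‖x‖ ^ 2 := by
        rw [Finset.mul_sum, Finset.sum_mul]
    _ ≤ T * T * ‖x‖ ^ 2 := by
        gcongr
        exact hs.sum_le_tsum _ fun j _ => norm_nonneg _

lemma IsSchurStable.isAsymptoticallyStableEquilibrium {n : ℕ} {M : Matrix (Fin n) (Fin n) ℝ}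
    (hM : IsSchurStable M) {f : (Fin n → ℝ) → Fin n → ℝ} (hf : ∀ x, f x = M *ᵥ x) :
    IsAsymptoticallyStableEquilibrium f 0 := by
  have hiter : ∀ (k : ℕ) (x : Fin n → ℝ), f^[k] x = M ^ k *ᵥ x := by
    intro k x
    induction k with
    | zero => simp
    | succ k ih => rw [Function.iterate_succ_apply', ih, hf, Matrix.mulVec_mulVec, ← pow_succ']
  refine ⟨by simp [hf], fun U hU => ?_, Eventually.of_forall fun x => ?_⟩
  · obtain ⟨ε, hε, hεU⟩ := Metric.mem_nhds_iff.mp hU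
    have hs := hM.summable_norm_pow
    set T := ∑' k : ℕ, ‖M ^ k‖ with hT
    have hT0 : 0 ≤ T := tsum_nonneg fun k => norm_nonneg _
    -- The `+ 1` keeps the radius finite and positive even when `T = 0`.
    refine ⟨Metric.ball 0 (ε / (T + 1)), Metric.ball_mem_nhds _ (by positivity), fun x hx k => ?_⟩
    apply hεU
    rw [mem_ball_zero_iff] at hx ⊢
    rw [hiter]
    have h2 : ‖M ^ k‖ ≤ T := hs.le_tsum k fun j _ => norm_nonneg _
    calc ‖M ^ k *ᵥ x‖ ≤ ‖M ^ k‖ * ‖x‖ := Matrix.linfty_opNorm_mulVec _ _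
      _ ≤ (T + 1) * ‖x‖ := by gcongr; linarith
      _ < (T + 1) * (ε / (T + 1)) := by gcongr
      _ = ε := by field_simp
  · simpa only [hiter] using hM.tendsto_pow_mulVec x

end PowerStability

/-! ### Quadratic forms and Lyapunov's criterion -/

section QuadForm

/-- The value `xᵀ P x` of the quadratic form of a square matrix. -/
def quadForm {ι : Type*} [Fintype ι] (P : Matrix ι ι ℝ) (x : ι → ℝ) : ℝ := x ⬝ᵥ (P *ᵥ x)

variable {ι : Type*} [Fintype ι]

lemma quadForm_add_left (P L : Matrix ι ι ℝ) (x : ι → ℝ) :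
    quadForm (P + L) x = quadForm P x + quadForm L x := by
  simp [quadForm, Matrix.add_mulVec]

lemma quadForm_sub_left (P L : Matrix ι ι ℝ) (x : ι → ℝ) :
    quadForm (P - L) x = quadForm P x - quadForm L x := by
  simp [quadForm, Matrix.sub_mulVec]

lemma quadForm_neg_left (P : Matrix ι ι ℝ) (x : ι → ℝ) : quadForm (-P) x = -quadForm P x := by
  simp [quadForm, Matrix.neg_mulVec]

@[simp] lemma quadForm_zero (P : Matrix ι ι ℝ) : quadForm P 0 = 0 := by
  simp [quadForm]

lemma Matrix.IsSymm.dotProduct_mulVec_comm {P : Matrix ι ι ℝ} (hP : P.IsSymm) (x y : ι → ℝ) :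
    y ⬝ᵥ (P *ᵥ x) = x ⬝ᵥ (P *ᵥ y) := by
  rw [dotProduct_comm, ← Matrix.vecMul_transpose, hP.eq, ← Matrix.dotProduct_mulVec]

lemma quadForm_add {P : Matrix ι ι ℝ} (hP : P.IsSymm) (x y : ι → ℝ) :
    quadForm P (x + y) = quadForm P x + quadForm P y + 2 * (x ⬝ᵥ (P *ᵥ y)) := by
  simp only [quadForm, Matrix.mulVec_add, dotProduct_add, add_dotProduct]
  rw [hP.dotProduct_mulVec_comm x y]
  ring

lemma Matrix.IsSymm.ext_quadForm {P L : Matrix ι ι ℝ} (hP : P.IsSymm) (hL : L.IsSymm)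
    (h : ∀ x, quadForm P x = quadForm L x) : P = L := by
  classical
  ext i j
  have h1 := quadForm_add hP (Pi.single i 1) (Pi.single j 1)
  have h2 := quadForm_add hL (Pi.single i 1) (Pi.single j 1)
  simp only [h] at h1
  have h3 : (Pi.single i 1 : ι → ℝ) ⬝ᵥ (P *ᵥ Pi.single j 1)
      = (Pi.single i 1 : ι → ℝ) ⬝ᵥ (L *ᵥ Pi.single j 1) := by linarith
  simpa using h3

lemma Matrix.PosDef.quadForm_pos {P : Matrix ι ι ℝ} (hP : P.PosDef) {x : ι → ℝ} (hx : x ≠ 0) :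
    0 < quadForm P x := by
  simpa [quadForm] using hP.dotProduct_mulVec_pos hx

lemma Matrix.PosDef.quadForm_nonneg {P : Matrix ι ι ℝ} (hP : P.PosDef) (x : ι → ℝ) :
    0 ≤ quadForm P x := by
  rcases eq_or_ne x 0 with rfl | hx
  · simp
  · exact (hP.quadForm_pos hx).le

lemma posDef_of_quadForm_pos {P : Matrix ι ι ℝ} (hP : P.IsSymm)
    (h : ∀ x, x ≠ 0 → 0 < quadForm P x) : P.PosDef := by
  refine Matrix.PosDef.of_dotProduct_mulVec_pos ?_ fun {x} hx => ?_
  · simpa [Matrix.IsHermitian, Matrix.IsSymm] using hP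
  · simpa [quadForm] using h x hx

lemma continuous_quadForm (P : Matrix ι ι ℝ) : Continuous (quadForm P) := by
  unfold quadForm
  fun_prop

lemma quadForm_smul (P : Matrix ι ι ℝ) (c : ℝ) (x : ι → ℝ) :
    quadForm P (c • x) = c ^ 2 * quadForm P x := by
  simp [quadForm, Matrix.mulVec_smul]
  ring

lemma exists_quadForm_le (P : Matrix ι ι ℝ) : ∃ C, 0 ≤ C ∧ ∀ x, quadForm P x ≤ C * ‖x‖ ^ 2 := by
  refine ⟨∑ i, ∑ j, |P i j|, by positivity, fun x => ?_⟩
  simp only [quadForm, dotProduct, Matrix.mulVec, Finset.mul_sum, Finset.sum_mul]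
  refine Finset.sum_le_sum fun i _ => Finset.sum_le_sum fun j _ => ?_
  have hi := norm_le_pi_norm x i
  have hj := norm_le_pi_norm x j
  calc x i * (P i j * x j) ≤ |x i * (P i j * x j)| := le_abs_self _
    _ = |P i j| * (‖x i‖ * ‖x j‖) := by simp only [abs_mul, Real.norm_eq_abs]; ring
    _ ≤ |P i j| * (‖x‖ * ‖x‖) := by gcongr
    _ = |P i j| * ‖x‖ ^ 2 := by ring

lemma Matrix.PosDef.exists_le_quadForm {P : Matrix ι ι ℝ} (hP : P.PosDef) :
    ∃ c, 0 < c ∧ ∀ x, c * ‖x‖ ^ 2 ≤ quadForm P x := by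
  rcases (Metric.sphere (0 : ι → ℝ) 1).eq_empty_or_nonempty with he | hne
  · refine ⟨1, one_pos, fun x => ?_⟩
    have hx : x = 0 := by
      by_contra hx
      have : ‖x‖⁻¹ • x ∈ Metric.sphere (0 : ι → ℝ) 1 := by
        simp [norm_smul, hx]
      simp [he] at this
    simp [hx]
  · obtain ⟨z, hz, hmin⟩ := (isCompact_sphere (0 : ι → ℝ) 1).exists_isMinOn hne
      (continuous_quadForm P).continuousOn
    have hz0 : z ≠ 0 := by
      rintro rfl
      simp at hz
    refine ⟨quadForm P z, hP.quadForm_pos hz0, fun x => ?_⟩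
    rcases eq_or_ne x 0 with rfl | hx
    · simp
    have hx' : ‖x‖ ≠ 0 := norm_ne_zero_iff.mpr hx
    have hmem : ‖x‖⁻¹ • x ∈ Metric.sphere (0 : ι → ℝ) 1 := by
      simp [norm_smul, hx]
    have h1 := isMinOn_iff.mp hmin _ hmem
    rw [quadForm_smul] at h1
    calc quadForm P z * ‖x‖ ^ 2 ≤ (‖x‖⁻¹ ^ 2 * quadForm P x) * ‖x‖ ^ 2 := by gcongr
      _ = quadForm P x := by field_simp

lemma Matrix.PosDef.exists_quadForm_le_mul {P : Matrix ι ι ℝ} (hP : P.PosDef)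
    (L : Matrix ι ι ℝ) : ∃ C, 0 ≤ C ∧ ∀ x, quadForm L x ≤ C * quadForm P x := by
  obtain ⟨c, hc, hcP⟩ := hP.exists_le_quadForm
  obtain ⟨C, hC, hCL⟩ := exists_quadForm_le L
  refine ⟨C / c, by positivity, fun x => (hCL x).trans ?_⟩
  calc C * ‖x‖ ^ 2 = C / c * (c * ‖x‖ ^ 2) := by field_simp
    _ ≤ C / c * quadForm P x := by gcongr; exact hcP x

lemma Matrix.PosDef.tendsto_zero_of_quadForm {P : Matrix ι ι ℝ} (hP : P.PosDef)
    {x : ℕ → ι → ℝ} (h : Tendsto (fun k => quadForm P (x k)) atTop (𝓝 0)) :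
    Tendsto x atTop (𝓝 0) := by
  obtain ⟨c, hc, hcP⟩ := hP.exists_le_quadForm
  have h1 : Tendsto (fun k => ‖x k‖ ^ 2) atTop (𝓝 0) := by
    refine squeeze_zero (fun k => by positivity) (fun k => ?_) (by simpa using h.const_mul c⁻¹)
    calc ‖x k‖ ^ 2 = c⁻¹ * (c * ‖x k‖ ^ 2) := by field_simp
      _ ≤ c⁻¹ * quadForm P (x k) := by gcongr; exact hcP _
  rw [tendsto_zero_iff_norm_tendsto_zero]
  have h2 := h1.sqrt
  simpa [Real.sqrt_sq] using h2

/-- Convergence of symmetric matrices follows from that of their quadratic forms. -/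
lemma exists_tendsto_of_quadForm {T : ℕ → Matrix ι ι ℝ} (hT : ∀ k, (T k).IsSymm)
    (h : ∀ x, ∃ c, Tendsto (fun k => quadForm (T k) x) atTop (𝓝 c)) :
    ∃ P, Tendsto T atTop (𝓝 P) := by
  classical
  choose g hg using h
  -- Polarization recovers each entry from values of the form.
  refine ⟨Matrix.of fun i j => (g (Pi.single i 1 + Pi.single j 1) - g (Pi.single i 1)
    - g (Pi.single j 1)) / 2, ?_⟩
  refine tendsto_pi_nhds.mpr fun i => tendsto_pi_nhds.mpr fun j => ?_
  have h1 := (((hg (Pi.single i 1 + Pi.single j 1)).sub (hg (Pi.single i 1))).sub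
    (hg (Pi.single j 1))).div_const 2
  refine h1.congr fun k => ?_
  rw [quadForm_add (hT k)]
  simp only [Matrix.mulVec_single_one, single_one_dotProduct, Matrix.col_apply]
  ring

/-- **Lyapunov's criterion** for Schur stability. -/
lemma isSchurStable_of_quadForm {n : ℕ} {M P : Matrix (Fin n) (Fin n) ℝ} (hP : P.IsSymm)
    (h0 : ∀ x, 0 ≤ quadForm P x) (hlt : ∀ x, x ≠ 0 → quadForm P (M *ᵥ x) < quadForm P x) :
    IsSchurStable M := by
  intro μ hμ
  rw [← Matrix.spectrum_toLin', ← Module.End.hasEigenvalue_iff_mem_spectrum] at hμ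
  obtain ⟨z, hz⟩ := hμ.exists_hasEigenvector
  have hz1 : M.map (algebraMap ℝ ℂ) *ᵥ z = μ • z := by
    simpa using hz.apply_eq_smul
  set a : Fin n → ℝ := fun i => (z i).re with ha
  set b : Fin n → ℝ := fun i => (z i).im with hb
  have hMa : M *ᵥ a = μ.re • a - μ.im • b := by
    ext i
    have := congrArg Complex.re (congrFun hz1 i)
    simpa [Matrix.mulVec, dotProduct, ha, hb] using this
  have hMb : M *ᵥ b = μ.re • b + μ.im • a := by
    ext i
    have := congrArg Complex.im (congrFun hz1 i)
    simpa [Matrix.mulVec, dotProduct, ha, hb] using this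
  -- `M` scales and rotates the pair of real and imaginary parts of the eigenvector; in the sum of
  -- the two forms the cross terms cancel.
  have hsum : quadForm P (M *ᵥ a) + quadForm P (M *ᵥ b)
      = ‖μ‖ ^ 2 * (quadForm P a + quadForm P b) := by
    rw [hMa, hMb, sub_eq_add_neg, ← neg_smul, quadForm_add hP, quadForm_add hP]
    simp only [quadForm_smul, Matrix.mulVec_smul, dotProduct_smul, smul_dotProduct, smul_eq_mul]
    rw [hP.dotProduct_mulVec_comm a b, Complex.sq_norm, Complex.normSq_apply]
    ring
  have hab : a ≠ 0 ∨ b ≠ 0 := by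
    by_contra! h
    refine hz.2 (funext fun i => Complex.ext ?_ ?_)
    · exact congrFun h.1 i
    · exact congrFun h.2 i
  have hle : ∀ x, quadForm P (M *ᵥ x) ≤ quadForm P x := fun x => by
    rcases eq_or_ne x 0 with rfl | hx
    · simp
    · exact (hlt x hx).le
  have hlt' : quadForm P (M *ᵥ a) + quadForm P (M *ᵥ b) < quadForm P a + quadForm P b := by
    rcases hab with h | h
    · exact add_lt_add_of_lt_of_le (hlt a h) (hle b)
    · exact add_lt_add_of_le_of_lt (hle a) (hlt b h)
  rw [hsum] at hlt'
  by_contra! hμ1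
  nlinarith [h0 a, h0 b, one_le_pow₀ hμ1 (n := 2)]

end QuadForm

/-! ### Antistable matrices and completion of the square -/

lemma IsAntistable.isUnit {n : ℕ} {M : Matrix (Fin n) (Fin n) ℝ} (hM : IsAntistable M) :
    IsUnit M := by
  by_contra h
  have h1 : (0 : ℂ) ∈ spectrum ℂ (M.map (algebraMap ℝ ℂ)) := by
    rw [spectrum.zero_mem_iff, Matrix.isUnit_iff_isUnit_det]
    rw [Matrix.isUnit_iff_isUnit_det] at h
    have : (M.map (algebraMap ℝ ℂ)).det = algebraMap ℝ ℂ M.det :=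
      ((algebraMap ℝ ℂ).map_det M).symm
    rw [this]
    simpa [isUnit_iff_ne_zero] using h
  have := hM 0 h1
  simp at this
  linarith

/-- The inverse of an antistable matrix is Schur stable. -/
lemma IsAntistable.isSchurStable_inv {n : ℕ} {M : Matrix (Fin n) (Fin n) ℝ}
    (hM : IsAntistable M) : IsSchurStable M⁻¹ := by
  have hu := hM.isUnit
  have hdet : IsUnit M.det := (Matrix.isUnit_iff_isUnit_det M).mp hu
  let f := (algebraMap ℝ ℂ).mapMatrix (m := Fin n)
  let a : (Matrix (Fin n) (Fin n) ℂ)ˣ :=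
    ⟨f M, f M⁻¹, by rw [← map_mul, Matrix.mul_nonsing_inv _ hdet, map_one],
      by rw [← map_mul, Matrix.nonsing_inv_mul _ hdet, map_one]⟩
  intro μ hμ
  have hμ' : μ ∈ spectrum ℂ ((a⁻¹ : (Matrix (Fin n) (Fin n) ℂ)ˣ) : Matrix (Fin n) (Fin n) ℂ) := hμ
  have hμ0 : μ ≠ 0 := spectrum.ne_zero_of_mem_of_unit hμ'
  have h1 : μ⁻¹ ∈ spectrum ℂ (a : Matrix (Fin n) (Fin n) ℂ) := by
    have := (spectrum.inv_mem_iff (r := Units.mk0 μ hμ0) (a := a⁻¹)).mp (by simpa using hμ')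
    simpa using this
  have h2 := hM _ h1
  rw [norm_inv] at h2
  exact (one_lt_inv₀ (norm_pos_iff.mpr hμ0)).mp h2

lemma quadForm_fromBlocks {n m : ℕ} (Q : Matrix (Fin n) (Fin n) ℝ) (S : Matrix (Fin m) (Fin n) ℝ)
    (R : Matrix (Fin m) (Fin m) ℝ) (x : Fin n → ℝ) (u : Fin m → ℝ) :
    quadForm (fromBlocks Q Sᵀ S R) (Sum.elim x u)
      = quadForm Q x + 2 * (u ⬝ᵥ (S *ᵥ x)) + quadForm R u := by
  have h : x ⬝ᵥ (Sᵀ *ᵥ u) = u ⬝ᵥ (S *ᵥ x) := by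
    rw [Matrix.mulVec_transpose, dotProduct_comm, Matrix.dotProduct_mulVec]
  simp only [quadForm, Matrix.fromBlocks_mulVec, Sum.elim_comp_inl, Sum.elim_comp_inr,
    sumElim_dotProduct_sumElim, dotProduct_add]
  rw [h]
  ring

lemma quadForm_mulVec_add_mulVec {n m : ℕ} {P : Matrix (Fin n) (Fin n) ℝ} (hP : P.IsSymm)
    (A : Matrix (Fin n) (Fin n) ℝ) (B : Matrix (Fin n) (Fin m) ℝ)
    (x : Fin n → ℝ) (u : Fin m → ℝ) :
    quadForm P (A *ᵥ x + B *ᵥ u)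
      = quadForm (Aᵀ * P * A) x + 2 * (u ⬝ᵥ ((Bᵀ * P * A) *ᵥ x)) + quadForm (Bᵀ * P * B) u := by
  have h : ∀ {k l : ℕ} (C : Matrix (Fin n) (Fin k) ℝ) (D : Matrix (Fin n) (Fin l) ℝ)
      (y : Fin k → ℝ) (z : Fin l → ℝ),
      (C *ᵥ y) ⬝ᵥ (P *ᵥ (D *ᵥ z)) = y ⬝ᵥ ((Cᵀ * P * D) *ᵥ z) := fun C D y z => by
    rw [← Matrix.vecMul_transpose, ← Matrix.dotProduct_mulVec, Matrix.mulVec_mulVec,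
      Matrix.mulVec_mulVec, Matrix.mul_assoc]
  rw [quadForm_add hP, hP.dotProduct_mulVec_comm (B *ᵥ u) (A *ᵥ x), h]
  simp only [quadForm, h]
  ring

namespace LQProblem

variable {n m : ℕ} (p : LQProblem n m)

/-- The right-hand side of the Riccati equation. -/
def riccati (P : Matrix (Fin n) (Fin n) ℝ) : Matrix (Fin n) (Fin n) ℝ :=
  p.Q + p.Aᵀ * P * p.A - (p.Sᵀ + p.Aᵀ * P * p.B) * p.gain P

/-- The matrix `R + Bᵀ P B`. -/
def inputWeight (P : Matrix (Fin n) (Fin n) ℝ) : Matrix (Fin m) (Fin m) ℝ :=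
  p.R + p.Bᵀ * P * p.B

/-- The closed-loop matrix `A - B K_P`. -/
def closedLoop (P : Matrix (Fin n) (Fin n) ℝ) : Matrix (Fin n) (Fin n) ℝ :=
  p.A - p.B * p.gain P

/-- The rotated stage cost `ℓ(x,u) + λ(x) - λ(A x + B u)`. -/
def rotatedCost (L : Matrix (Fin n) (Fin n) ℝ) (x : Fin n → ℝ) (u : Fin m → ℝ) : ℝ :=
  quadForm (p.rotatedH L) (Sum.elim x u)

lemma inputWeight_isSymm {P : Matrix (Fin n) (Fin n) ℝ} (hP : P.IsSymm) :
    (p.inputWeight P).IsSymm := by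
  simp only [inputWeight, Matrix.IsSymm, Matrix.transpose_add, Matrix.transpose_mul,
    Matrix.transpose_transpose, hP.eq, p.R_symm.eq, Matrix.mul_assoc]

lemma transpose_add_mul {P : Matrix (Fin n) (Fin n) ℝ} (hP : P.IsSymm) :
    (p.S + p.Bᵀ * P * p.A)ᵀ = p.Sᵀ + p.Aᵀ * P * p.B := by
  simp only [Matrix.transpose_add, Matrix.transpose_mul, Matrix.transpose_transpose, hP.eq,
    Matrix.mul_assoc]

lemma riccati_isSymm {P : Matrix (Fin n) (Fin n) ℝ} (hP : P.IsSymm) : (p.riccati P).IsSymm := by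
  have h1 : (p.inputWeight P)⁻¹ᵀ = (p.inputWeight P)⁻¹ := by
    rw [Matrix.transpose_nonsing_inv, (p.inputWeight_isSymm hP).eq]
  have h2 := p.transpose_add_mul hP
  have h3 : (p.Sᵀ + p.Aᵀ * P * p.B)ᵀ = p.S + p.Bᵀ * P * p.A := by
    rw [← h2, Matrix.transpose_transpose]
  unfold riccati gain
  unfold inputWeight at h1
  rw [Matrix.IsSymm, Matrix.transpose_sub, Matrix.transpose_mul, Matrix.transpose_mul, h1, h2, h3]
  simp only [Matrix.transpose_add, Matrix.transpose_mul, Matrix.transpose_transpose, hP.eq,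
    p.Q_symm.eq, Matrix.mul_assoc]

lemma stageCost_eq (x : Fin n → ℝ) (u : Fin m → ℝ) :
    p.stageCost x u = quadForm p.Q x + 2 * (u ⬝ᵥ (p.S *ᵥ x)) + quadForm p.R u :=
  quadForm_fromBlocks p.Q p.S p.R x u

lemma rotatedCost_eq {L : Matrix (Fin n) (Fin n) ℝ} (hL : L.IsSymm) (x : Fin n → ℝ)
    (u : Fin m → ℝ) :
    p.rotatedCost L x u = p.stageCost x u + quadForm L x - quadForm L (p.A *ᵥ x + p.B *ᵥ u) := by
  have h : p.Sᵀ - p.Aᵀ * L * p.B = (p.S - p.Bᵀ * L * p.A)ᵀ := by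
    simp only [Matrix.transpose_sub, Matrix.transpose_mul, Matrix.transpose_transpose, hL.eq,
      Matrix.mul_assoc]
  rw [rotatedCost, rotatedH, h, quadForm_fromBlocks, quadForm_mulVec_add_mulVec hL, stageCost_eq]
  simp only [quadForm_sub_left, quadForm_add_left, Matrix.sub_mulVec, dotProduct_sub]
  ring

/-- Completion of the square. -/
lemma stageCost_add_quadForm {P : Matrix (Fin n) (Fin n) ℝ} (hP : P.IsSymm)
    (hu : IsUnit (p.inputWeight P)) (x : Fin n → ℝ) (u : Fin m → ℝ) :
    p.stageCost x u + quadForm P (p.A *ᵥ x + p.B *ᵥ u)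
      = quadForm (p.riccati P) x + quadForm (p.inputWeight P) (u + p.gain P *ᵥ x) := by
  have hdet := (Matrix.isUnit_iff_isUnit_det _).mp hu
  have hK : p.inputWeight P * p.gain P = p.S + p.Bᵀ * P * p.A := by
    rw [gain]
    exact Matrix.mul_nonsing_inv_cancel_left _ _ hdet
  have h1 : quadForm (p.inputWeight P) (p.gain P *ᵥ x)
      = quadForm ((p.Sᵀ + p.Aᵀ * P * p.B) * p.gain P) x := by
    rw [quadForm, Matrix.mulVec_mulVec, hK, dotProduct_comm, ← Matrix.vecMul_transpose,
      p.transpose_add_mul hP, ← Matrix.dotProduct_mulVec, Matrix.mulVec_mulVec, quadForm]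
  rw [quadForm_add (p.inputWeight_isSymm hP), h1, Matrix.mulVec_mulVec, hK,
    quadForm_mulVec_add_mulVec hP, stageCost_eq, riccati, inputWeight]
  simp only [quadForm_sub_left, quadForm_add_left, Matrix.add_mulVec, dotProduct_add]
  ring

lemma mulVec_add_mulVec_eq (P : Matrix (Fin n) (Fin n) ℝ) (x : Fin n → ℝ) (v : Fin m → ℝ) :
    p.A *ᵥ x + p.B *ᵥ (v - p.gain P *ᵥ x) = p.closedLoop P *ᵥ x + p.B *ᵥ v := by
  simp only [closedLoop, Matrix.sub_mulVec, Matrix.mulVec_sub, Matrix.mulVec_mulVec]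
  abel

lemma mulVec_add_mulVec_neg (P : Matrix (Fin n) (Fin n) ℝ) (x : Fin n → ℝ) :
    p.A *ᵥ x + p.B *ᵥ (-(p.gain P *ᵥ x)) = p.closedLoop P *ᵥ x := by
  simpa using p.mulVec_add_mulVec_eq P x 0

/-! ### DARE solutions compared with −Λ -/

variable {p} {L P : Matrix (Fin n) (Fin n) ℝ}

lemma rotatedCost_nonneg (hH : (p.rotatedH L).PosDef) (x : Fin n → ℝ) (u : Fin m → ℝ) :
    0 ≤ p.rotatedCost L x u :=
  hH.quadForm_nonneg _

lemma rotatedCost_pos (hH : (p.rotatedH L).PosDef) {x : Fin n → ℝ} {u : Fin m → ℝ}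
    (h : x ≠ 0 ∨ u ≠ 0) : 0 < p.rotatedCost L x u := by
  refine hH.quadForm_pos fun h0 => ?_
  rcases h with h | h
  · exact h (funext fun i => congrFun h0 (Sum.inl i))
  · exact h (funext fun i => congrFun h0 (Sum.inr i))

/-- `R + Bᵀ P B` is positive definite if `-Λ ≤ P`. -/
lemma inputWeight_posDef (hL : L.IsSymm) (hH : (p.rotatedH L).PosDef) (hP : P.IsSymm)
    (h : ∀ x, 0 ≤ quadForm (P + L) x) : (p.inputWeight P).PosDef := by
  refine posDef_of_quadForm_pos (p.inputWeight_isSymm hP) fun u hu => ?_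
  -- At `x = 0` the rotated cost is the form of R − BᵀΛB; adding that of Bᵀ(P + Λ)B gives R + BᵀPB.
  have h1 := rotatedCost_pos hH (x := 0) (u := u) (Or.inr hu)
  have h2 := h (p.B *ᵥ u)
  have h3 := quadForm_mulVec_add_mulVec hP p.A p.B 0 u
  rw [rotatedCost_eq p hL, stageCost_eq] at h1
  simp only [Matrix.mulVec_zero, quadForm_zero, dotProduct_zero, zero_add, mul_zero, add_zero]
    at h1 h3
  rw [quadForm_add_left] at h2
  rw [inputWeight, quadForm_add_left]
  linarith

lemma IsDARESolution.riccati_eq (hP : p.IsDARESolution P) : p.riccati P = P := hP.eq.symm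

/-- The dissipation identity of a DARE solution, in terms of the rotated cost. -/
lemma IsDARESolution.rotatedCost_add (hP : p.IsDARESolution P) (hL : L.IsSymm)
    (x : Fin n → ℝ) (u : Fin m → ℝ) :
    p.rotatedCost L x u + quadForm (P + L) (p.A *ᵥ x + p.B *ᵥ u)
      = quadForm (P + L) x + quadForm (p.inputWeight P) (u + p.gain P *ᵥ x) := by
  have h := p.stageCost_add_quadForm hP.symm hP.isUnit x u
  rw [hP.riccati_eq] at h
  rw [rotatedCost_eq p hL, quadForm_add_left, quadForm_add_left]
  linarith

lemma IsDARESolution.rotatedCost_add_closedLoop (hP : p.IsDARESolution P) (hL : L.IsSymm)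
    (x : Fin n → ℝ) :
    p.rotatedCost L x (-(p.gain P *ᵥ x)) + quadForm (P + L) (p.closedLoop P *ᵥ x)
      = quadForm (P + L) x := by
  have h := hP.rotatedCost_add hL x (-(p.gain P *ᵥ x))
  simpa [p.mulVec_add_mulVec_neg] using h

/-- Along the closed loop the form of P + Λ never increases, and it tends to 0 because the state
does. -/
lemma IsStabilizingSolution.quadForm_nonneg (hP : p.IsStabilizingSolution P) (hL : L.IsSymm)
    (hH : (p.rotatedH L).PosDef) (x : Fin n → ℝ) : 0 ≤ quadForm (P + L) x := by
  have hk : ∀ k : ℕ, quadForm (P + L) (p.closedLoop P ^ k *ᵥ x) ≤ quadForm (P + L) x := by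
    intro k
    induction k with
    | zero => simp
    | succ k ih =>
      have h1 := hP.1.rotatedCost_add_closedLoop hL (p.closedLoop P ^ k *ᵥ x)
      have h2 := rotatedCost_nonneg hH (p.closedLoop P ^ k *ᵥ x)
        (-(p.gain P *ᵥ (p.closedLoop P ^ k *ᵥ x)))
      rw [pow_succ', ← Matrix.mulVec_mulVec]
      linarith
  have hlim := ((continuous_quadForm (P + L)).tendsto 0).comp (hP.2.tendsto_pow_mulVec x)
  rw [quadForm_zero] at hlim
  exact le_of_tendsto' hlim hk

/-- The closed loop run backwards is Schur stable, and in backward time the form of P + Λ never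
decreases while tending to 0, so it is nonpositive. One further backward step, with its positive
rotated cost, makes this strict. -/
lemma IsAntistabilizingSolution.neg_add_posDef (hP : p.IsAntistabilizingSolution P)
    (hL : L.IsSymm) (hH : (p.rotatedH L).PosDef) : (-(P + L)).PosDef := by
  have hu := hP.2.isUnit
  have hdet := (Matrix.isUnit_iff_isUnit_det _).mp hu
  have hdet' : IsUnit (p.closedLoop P).det := hdet
  set D := (p.closedLoop P)⁻¹ with hD
  have hstep : ∀ y : Fin n → ℝ, quadForm (P + L) y
      = quadForm (P + L) (D *ᵥ y) - p.rotatedCost L (D *ᵥ y) (-(p.gain P *ᵥ (D *ᵥ y))) := by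
    intro y
    have h1 := hP.1.rotatedCost_add_closedLoop hL (D *ᵥ y)
    have h2 : p.closedLoop P *ᵥ (D *ᵥ y) = y := by
      rw [Matrix.mulVec_mulVec, hD, Matrix.mul_nonsing_inv _ hdet', Matrix.one_mulVec]
    rw [h2] at h1
    linarith
  have hnonpos : ∀ y : Fin n → ℝ, quadForm (P + L) y ≤ 0 := by
    intro y
    have hk : ∀ k : ℕ, quadForm (P + L) y ≤ quadForm (P + L) (D ^ k *ᵥ y) := by
      intro k
      induction k with
      | zero => simp
      | succ k ih =>
        have h1 := hstep (D ^ k *ᵥ y)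
        have h2 := rotatedCost_nonneg hH (D *ᵥ (D ^ k *ᵥ y))
          (-(p.gain P *ᵥ (D *ᵥ (D ^ k *ᵥ y))))
        rw [pow_succ', ← Matrix.mulVec_mulVec]
        linarith
    have hS : IsSchurStable D := hP.2.isSchurStable_inv
    have hlim := ((continuous_quadForm (P + L)).tendsto 0).comp (hS.tendsto_pow_mulVec y)
    rw [quadForm_zero] at hlim
    exact ge_of_tendsto' hlim hk
  refine posDef_of_quadForm_pos (hP.1.symm.add hL).neg fun y hy => ?_
  have hDy : D *ᵥ y ≠ 0 := fun h0 => hy <| by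
    have := congrArg (p.closedLoop P *ᵥ ·) h0
    simpa [hD, Matrix.mulVec_mulVec, Matrix.mul_nonsing_inv _ hdet'] using this
  have h1 := hstep y
  have h2 := rotatedCost_pos hH (u := -(p.gain P *ᵥ (D *ᵥ y))) (Or.inl hDy)
  have h3 := hnonpos (D *ᵥ y)
  rw [quadForm_neg_left]
  linarith

/-- Here P + Λ is negative, so `LQProblem.inputWeight_posDef` does not apply. Instead, invertibility
of the closed loop provides for each `v` a state `x` that the input `v - K x` sends to 0; the
dissipation identity there writes the weight of `v` as the rotated cost minus the form of P + Λ at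
`x`. -/
lemma IsAntistabilizingSolution.inputWeight_posDef (hP : p.IsAntistabilizingSolution P)
    (hL : L.IsSymm) (hH : (p.rotatedH L).PosDef) : (p.inputWeight P).PosDef := by
  have hdet : IsUnit (p.closedLoop P).det := (Matrix.isUnit_iff_isUnit_det _).mp hP.2.isUnit
  have hneg := hP.neg_add_posDef hL hH
  refine posDef_of_quadForm_pos (p.inputWeight_isSymm hP.1.symm) fun v hv => ?_
  set x : Fin n → ℝ := -((p.closedLoop P)⁻¹ *ᵥ (p.B *ᵥ v)) with hx
  have hx0 : p.closedLoop P *ᵥ x + p.B *ᵥ v = 0 := by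
    rw [hx, Matrix.mulVec_neg, Matrix.mulVec_mulVec, Matrix.mul_nonsing_inv _ hdet,
      Matrix.one_mulVec, neg_add_cancel]
  have h1 := hP.1.rotatedCost_add hL x (v - p.gain P *ᵥ x)
  rw [p.mulVec_add_mulVec_eq, hx0, quadForm_zero, sub_add_cancel] at h1
  have h2 := hneg.quadForm_nonneg x
  rw [quadForm_neg_left] at h2
  have h3 : 0 < p.rotatedCost L x (v - p.gain P *ᵥ x) := by
    refine rotatedCost_pos hH ?_
    by_contra! h
    rw [h.1] at h
    exact hv (by simpa using h.2)
  linarith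

end LQProblem

/-! ### Value iteration and the stabilizing solution -/

lemma quadForm_mulVec {ι κ : Type*} [Fintype ι] [Fintype κ] (P : Matrix ι ι ℝ)
    (F : Matrix ι κ ℝ) (y : κ → ℝ) : quadForm P (F *ᵥ y) = quadForm (Fᵀ * P * F) y := by
  simp only [quadForm]
  rw [← Matrix.mulVec_mulVec, ← Matrix.mulVec_mulVec, Matrix.dotProduct_mulVec y Fᵀ,
    Matrix.vecMul_transpose]

namespace LQProblem

variable {n m : ℕ} {p : LQProblem n m} {L P : Matrix (Fin n) (Fin n) ℝ}

/-- With `quadForm_riccati_eq`, this makes `riccati` the Bellman operator: a minimum over inputs,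
attained at the feedback of `P`. -/
lemma quadForm_riccati_le (hP : P.IsSymm) (hw : (p.inputWeight P).PosDef) (x : Fin n → ℝ)
    (u : Fin m → ℝ) :
    quadForm (p.riccati P) x ≤ p.stageCost x u + quadForm P (p.A *ᵥ x + p.B *ᵥ u) := by
  have h1 := p.stageCost_add_quadForm hP hw.isUnit x u
  have h2 := hw.quadForm_nonneg (u + p.gain P *ᵥ x)
  linarith

lemma quadForm_riccati_eq (hP : P.IsSymm) (hw : (p.inputWeight P).PosDef) (x : Fin n → ℝ) :
    quadForm (p.riccati P) x = p.stageCost x (-(p.gain P *ᵥ x))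
      + quadForm P (p.A *ᵥ x + p.B *ᵥ (-(p.gain P *ᵥ x))) := by
  have h1 := p.stageCost_add_quadForm hP hw.isUnit x (-(p.gain P *ᵥ x))
  rw [neg_add_cancel, quadForm_zero] at h1
  linarith

lemma quadForm_riccati_add_nonneg (hL : L.IsSymm) (hH : (p.rotatedH L).PosDef) (hP : P.IsSymm)
    (h : ∀ x, 0 ≤ quadForm (P + L) x) (x : Fin n → ℝ) : 0 ≤ quadForm (p.riccati P + L) x := by
  have h1 := quadForm_riccati_eq hP (inputWeight_posDef hL hH hP h) x
  have h2 := h (p.A *ᵥ x + p.B *ᵥ (-(p.gain P *ᵥ x)))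
  have h3 := rotatedCost_nonneg hH x (-(p.gain P *ᵥ x))
  rw [rotatedCost_eq p hL] at h3
  rw [quadForm_add_left] at h2 ⊢
  linarith

/-- T k + Λ is the k-step value of the rotated problem with zero terminal cost. It is at most the
rotated cost of any stabilizing feedback, whose sum is bounded because the powers of the closed loop
are summable. -/
lemma exists_quadForm_add_le (hstab : p.IsStabilizable) (hL : L.IsSymm)
    {T : ℕ → Matrix (Fin n) (Fin n) ℝ} (h0 : T 0 = -L) (hT : ∀ k, T (k + 1) = p.riccati (T k))
    (hsymm : ∀ k, (T k).IsSymm) (hw : ∀ k, (p.inputWeight (T k)).PosDef) (x : Fin n → ℝ) :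
    ∃ C, ∀ k, quadForm (T k + L) x ≤ C := by
  obtain ⟨K, hK⟩ := hstab
  set M := p.A - p.B * K with hM
  have hcl : ∀ y : Fin n → ℝ, p.A *ᵥ y + p.B *ᵥ (-(K *ᵥ y)) = M *ᵥ y := fun y => by
    rw [hM, Matrix.sub_mulVec, Matrix.mulVec_neg, Matrix.mulVec_mulVec, sub_eq_add_neg]
  have hle : ∀ (k : ℕ) (y : Fin n → ℝ), quadForm (T k + L) y
      ≤ ∑ j ∈ Finset.range k, p.rotatedCost L (M ^ j *ᵥ y) (-(K *ᵥ (M ^ j *ᵥ y))) := by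
    intro k
    induction k with
    | zero => intro y; simp [h0, quadForm]
    | succ k ih =>
      intro y
      have h1 := quadForm_riccati_le (hsymm k) (hw k) y (-(K *ᵥ y))
      have h2 := ih (M *ᵥ y)
      simp only [Matrix.mulVec_mulVec _ (M ^ _) M, ← pow_succ] at h2
      rw [Finset.sum_range_succ', hT, quadForm_add_left, pow_zero, Matrix.one_mulVec,
        rotatedCost_eq p hL y, hcl]
      rw [hcl] at h1
      rw [quadForm_add_left] at h2
      linarith
  obtain ⟨C, hC⟩ := hK.exists_sum_sq_norm_le
  -- `F` maps `y` to the pair (y, −Ky), so the rotated cost under feedback is a quadratic form in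
  -- `y`.
  set F := Matrix.fromRows (1 : Matrix (Fin n) (Fin n) ℝ) (-K) with hF
  obtain ⟨D, hD0, hD⟩ := exists_quadForm_le (Fᵀ * p.rotatedH L * F)
  refine ⟨D * (C * ‖x‖ ^ 2), fun k => (hle k x).trans ?_⟩
  calc ∑ j ∈ Finset.range k, p.rotatedCost L (M ^ j *ᵥ x) (-(K *ᵥ (M ^ j *ᵥ x)))
      ≤ ∑ j ∈ Finset.range k, D * ‖M ^ j *ᵥ x‖ ^ 2 := by
        refine Finset.sum_le_sum fun j _ => ?_
        have h1 := hD (M ^ j *ᵥ x)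
        rwa [← quadForm_mulVec, hF, Matrix.fromRows_mulVec, Matrix.one_mulVec,
          Matrix.neg_mulVec] at h1
    _ ≤ D * (C * ‖x‖ ^ 2) := by
        rw [← Finset.mul_sum]
        gcongr
        exact hC x k

lemma continuousAt_riccati (hu : IsUnit (p.inputWeight P)) : ContinuousAt p.riccati P := by
  have h1 : Continuous p.inputWeight := by
    unfold inputWeight
    fun_prop
  have hdet : ContinuousAt Ring.inverse (p.inputWeight P).det := by
    rw [Ring.inverse_eq_inv']
    exact continuousAt_inv₀ ((Matrix.isUnit_iff_isUnit_det _).mp hu).ne_zero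
  have h2 : ContinuousAt (fun P => (p.inputWeight P)⁻¹) P :=
    ContinuousAt.comp (f := p.inputWeight) (g := fun M => M⁻¹)
      (continuousAt_matrix_inv _ hdet) h1.continuousAt
  have h3 : Continuous fun P : Matrix (Fin n) (Fin n) ℝ => p.S + p.Bᵀ * P * p.A := by fun_prop
  have h4 : Continuous fun P : Matrix (Fin n) (Fin n) ℝ => p.Q + p.Aᵀ * P * p.A := by fun_prop
  have h5 : Continuous fun P : Matrix (Fin n) (Fin n) ℝ => p.Sᵀ + p.Aᵀ * P * p.B := by fun_prop
  have hmul : ∀ {a b c : ℕ},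
      Continuous fun q : Matrix (Fin a) (Fin b) ℝ × Matrix (Fin b) (Fin c) ℝ => q.1 * q.2 := continuous_fst.matrix_mul continuous_snd
  have h6 : ContinuousAt p.gain P :=
    hmul.continuousAt.comp (f := fun P => ((p.inputWeight P)⁻¹, p.S + p.Bᵀ * P * p.A))
      (h2.prodMk h3.continuousAt)
  exact h4.continuousAt.sub <|
    hmul.continuousAt.comp (f := fun P => (p.Sᵀ + p.Aᵀ * P * p.B, p.gain P))
      (h5.continuousAt.prodMk h6)

/-- Existence of the stabilizing solution, by value iteration. -/
lemma exists_isStabilizingSolution (hstab : p.IsStabilizable) (hL : L.IsSymm)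
    (hH : (p.rotatedH L).PosDef) : ∃ P, p.IsStabilizingSolution P := by
  set T : ℕ → Matrix (Fin n) (Fin n) ℝ := fun k => p.riccati^[k] (-L) with hTdef
  have h0 : T 0 = -L := rfl
  have hT : ∀ k, T (k + 1) = p.riccati (T k) := fun k => Function.iterate_succ_apply' _ _ _
  have hinv : ∀ k, (T k).IsSymm ∧ ∀ x, 0 ≤ quadForm (T k + L) x := by
    intro k
    induction k with
    | zero => exact ⟨hL.neg, fun x => by simp [h0, quadForm]⟩
    | succ k ih =>
      rw [hT]
      exact ⟨p.riccati_isSymm ih.1, quadForm_riccati_add_nonneg hL hH ih.1 ih.2⟩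
  have hw : ∀ k, (p.inputWeight (T k)).PosDef := fun k =>
    inputWeight_posDef hL hH (hinv k).1 (hinv k).2
  have hmono : ∀ k x, quadForm (T k) x ≤ quadForm (T (k + 1)) x := by
    intro k
    induction k with
    | zero =>
      intro x
      have := (hinv 1).2 x
      rw [quadForm_add_left] at this
      rw [h0, quadForm_neg_left]
      linarith
    | succ k ih =>
      intro x
      -- Both Bellman expressions are evaluated at the minimizer for `T (k + 1)`, which is merely
      -- admissible for `T k`.
      rw [hT (k + 1), quadForm_riccati_eq (hinv (k + 1)).1 (hw (k + 1))]
      nth_rewrite 1 [hT k]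
      refine (quadForm_riccati_le (hinv k).1 (hw k) x
        (-(p.gain (T (k + 1)) *ᵥ x))).trans ?_
      gcongr
      exact ih _
  have hconv : ∀ x, ∃ c, Tendsto (fun k => quadForm (T k) x) atTop (𝓝 c) := by
    intro x
    obtain ⟨C, hC⟩ := exists_quadForm_add_le hstab hL h0 hT (fun k => (hinv k).1) hw x
    refine ⟨_, tendsto_atTop_ciSup (monotone_nat_of_le_succ fun k => hmono k x)
      ⟨C - quadForm L x, ?_⟩⟩
    rintro _ ⟨k, rfl⟩
    have := hC k
    rw [quadForm_add_left] at this
    simp only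
    linarith
  obtain ⟨P, hP⟩ := exists_tendsto_of_quadForm (fun k => (hinv k).1) hconv
  have hPsymm : P.IsSymm := by
    have h1 : Tendsto (fun k => (T k)ᵀ) atTop (𝓝 Pᵀ) :=
      (continuous_id.matrix_transpose.tendsto P).comp hP
    exact tendsto_nhds_unique (h1.congr fun k => (hinv k).1) hP
  have hPL : ∀ x, 0 ≤ quadForm (P + L) x := by
    intro x
    have hc : Continuous fun M : Matrix (Fin n) (Fin n) ℝ => quadForm (M + L) x := by
      unfold quadForm
      fun_prop
    exact ge_of_tendsto' ((hc.tendsto P).comp hP) fun k => (hinv k).2 x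
  have hPu := (inputWeight_posDef hL hH hPsymm hPL).isUnit
  have hPeq : P = p.riccati P := by
    refine tendsto_nhds_unique ((tendsto_add_atTop_iff_nat 1).mpr hP) ?_
    simp only [hT]
    exact (continuousAt_riccati hPu).tendsto.comp hP
  have hdare : p.IsDARESolution P := ⟨hPsymm, hPu, hPeq⟩
  -- P + Λ is a Lyapunov function: each step loses a positive rotated cost.
  refine ⟨P, hdare, isSchurStable_of_quadForm (hPsymm.add hL) hPL fun x hx => ?_⟩
  have h1 := hdare.rotatedCost_add_closedLoop hL x
  have h2 := rotatedCost_pos hH (u := -(p.gain P *ᵥ x)) (Or.inl hx)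
  unfold closedLoop at h1
  linarith

/-! ### Horizon costs and optimality -/

lemma horizonCost_eq_add_quadForm (P' : Matrix (Fin n) (Fin n) ℝ) (x₀ : Fin n → ℝ) (u : ℕ → Fin m → ℝ)
    (N : ℕ) : p.horizonCost P' x₀ u N
      = p.horizonCost P x₀ u N + quadForm (P' - P) (p.state x₀ u N) := by
  rw [quadForm_sub_left]
  simp only [horizonCost, quadForm]
  ring

lemma IsDARESolution.horizonCost_eq (hP : p.IsDARESolution P) (x₀ : Fin n → ℝ)
    (u : ℕ → Fin m → ℝ) (N : ℕ) :
    p.horizonCost P x₀ u N = quadForm P x₀ + ∑ k ∈ Finset.range N,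
      quadForm (p.inputWeight P) (u k + p.gain P *ᵥ p.state x₀ u k) := by
  induction N with
  | zero => simp [horizonCost, state, quadForm]
  | succ N ih =>
    have h := p.stageCost_add_quadForm hP.symm hP.isUnit (p.state x₀ u N) (u N)
    rw [hP.riccati_eq] at h
    rw [Finset.sum_range_succ, ← add_assoc, ← ih, horizonCost, horizonCost,
      Finset.sum_range_succ, add_assoc, add_assoc]
    simp only [quadForm] at h ⊢
    rw [state, h]

/-- If the costs for the terminal cost matrix `P + E`, with `P` antistabilizing and `E` positive
definite, are bounded along a subsequence, then the state converges to zero. -/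
lemma IsAntistabilizingSolution.tendsto_state (hP : p.IsAntistabilizingSolution P)
    (hL : L.IsSymm) (hH : (p.rotatedH L).PosDef) {E : Matrix (Fin n) (Fin n) ℝ} (hE : E.PosDef)
    {x₀ : Fin n → ℝ} {u : ℕ → Fin m → ℝ} {c : ℝ}
    (hc : ∃ᶠ N in atTop, p.horizonCost (P + E) x₀ u N ≤ c) :
    Tendsto (p.state x₀ u) atTop (𝓝 0) := by
  set x := p.state x₀ u with hx
  have hw := hP.inputWeight_posDef hL hH
  have hneg := hP.neg_add_posDef hL hH
  -- Positive definiteness of E lets the terminal penalty dominate the term −(P + Λ) at `x N` in the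
  -- telescoped rotated cost.
  obtain ⟨C, hC0, hC⟩ := hE.exists_quadForm_le_mul (-(P + L))
  have hsum : ∀ N, ∑ k ∈ Finset.range N, p.rotatedCost L (x k) (u k)
      = quadForm (-(P + L)) (x N) - quadForm (-(P + L)) x₀
        + ∑ k ∈ Finset.range N, quadForm (p.inputWeight P) (u k + p.gain P *ᵥ x k) := by
    intro N
    induction N with
    | zero => simp [hx, state]
    | succ N ih =>
      have h := hP.1.rotatedCost_add hL (x N) (u N)
      have h' : x (N + 1) = p.A *ᵥ x N + p.B *ᵥ u N := rfl
      rw [← h'] at h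
      rw [Finset.sum_range_succ, Finset.sum_range_succ, ih]
      simp only [quadForm_neg_left]
      linarith
  have hbound : ∀ N, ∑ k ∈ Finset.range N, p.rotatedCost L (x k) (u k)
      ≤ (C + 1) * (c - quadForm P x₀) := by
    intro N
    obtain ⟨N', hN, hN'⟩ := (frequently_atTop.mp hc) N
    -- Rotated costs are nonnegative, so a bound at some later horizon `N'` suffices. There the
    -- squares contribute at most c − x₀ᵀPx₀ and the terminal term at most `C` times that, whence `C
    -- + 1`.
    refine (Finset.sum_le_sum_of_subset_of_nonneg (Finset.range_mono hN)
      fun k _ _ => rotatedCost_nonneg hH _ _).trans ?_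
    rw [horizonCost_eq_add_quadForm (P := P), hP.1.horizonCost_eq, add_sub_cancel_left] at hN'
    rw [hsum]
    have h1 := hC (x N')
    have h2 := hE.quadForm_nonneg (x N')
    have h3 := hneg.quadForm_nonneg x₀
    have h4 : 0 ≤ ∑ k ∈ Finset.range N',
        quadForm (p.inputWeight P) (u k + p.gain P *ᵥ x k) :=
      Finset.sum_nonneg fun k _ => hw.quadForm_nonneg _
    have h5 : C * quadForm E (x N') ≤ C * (c - quadForm P x₀) := by
      gcongr
      linarith
    linarith
  have hr := (summable_of_sum_range_le (fun k => rotatedCost_nonneg hH (x k) (u k))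
    hbound).tendsto_atTop_zero
  have hz := hH.tendsto_zero_of_quadForm (x := fun k => Sum.elim (x k) (u k)) hr
  exact tendsto_pi_nhds.mpr fun i => (tendsto_pi_nhds.mp hz) (Sum.inl i)

lemma tendsto_quadForm_state (D : Matrix (Fin n) (Fin n) ℝ) {x : ℕ → Fin n → ℝ}
    (hx : Tendsto x atTop (𝓝 0)) : Tendsto (fun k => quadForm D (x k)) atTop (𝓝 0) := by
  simpa [Function.comp_def] using ((continuous_quadForm D).tendsto 0).comp hx

/-- The input sequence generated by the feedback `u = -K_P x`. -/
def feedbackInput (p : LQProblem n m) (P : Matrix (Fin n) (Fin n) ℝ) (x₀ : Fin n → ℝ) (k : ℕ) :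
    Fin m → ℝ :=
  -(p.gain P *ᵥ (p.closedLoop P ^ k *ᵥ x₀))

lemma state_feedbackInput (x₀ : Fin n → ℝ) (k : ℕ) :
    p.state x₀ (p.feedbackInput P x₀) k = p.closedLoop P ^ k *ᵥ x₀ := by
  induction k with
  | zero => simp [state]
  | succ k ih =>
    rw [state, ih, feedbackInput, p.mulVec_add_mulVec_neg, Matrix.mulVec_mulVec, ← pow_succ']

lemma eq_feedbackInput {x₀ : Fin n → ℝ} {u : ℕ → Fin m → ℝ}
    (hu : ∀ k, u k = -(p.gain P *ᵥ p.state x₀ u k)) : u = p.feedbackInput P x₀ := by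
  have hx : ∀ k, p.state x₀ u k = p.closedLoop P ^ k *ᵥ x₀ := by
    intro k
    induction k with
    | zero => simp [state]
    | succ k ih =>
      rw [state, hu k, p.mulVec_add_mulVec_neg, ih, Matrix.mulVec_mulVec, ← pow_succ']
  funext k
  rw [hu k, hx k, feedbackInput]

lemma IsStabilizingSolution.tendsto_horizonCost (hP : p.IsStabilizingSolution P)
    (P' : Matrix (Fin n) (Fin n) ℝ) (x₀ : Fin n → ℝ) :
    Tendsto (fun N => p.horizonCost P' x₀ (p.feedbackInput P x₀) N) atTop
      (𝓝 (quadForm P x₀)) := by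
  have hx : Tendsto (p.state x₀ (p.feedbackInput P x₀)) atTop (𝓝 0) := by
    refine (hP.2.tendsto_pow_mulVec x₀).congr fun k => ?_
    rw [state_feedbackInput, closedLoop]
  have h1 := (tendsto_quadForm_state (P' - P) hx).const_add (quadForm P x₀)
  rw [add_zero] at h1
  refine h1.congr fun N => ?_
  rw [horizonCost_eq_add_quadForm (P := P), hP.1.horizonCost_eq]
  simp [state_feedbackInput, feedbackInput]

lemma IsStabilizingSolution.quadForm_le_horizonCost (hP : p.IsStabilizingSolution P)
    (hL : L.IsSymm) (hH : (p.rotatedH L).PosDef) (x₀ : Fin n → ℝ) (u : ℕ → Fin m → ℝ) (N : ℕ) :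
    quadForm P x₀ ≤ p.horizonCost P x₀ u N := by
  rw [hP.1.horizonCost_eq]
  have hw := inputWeight_posDef hL hH hP.1.symm (hP.quadForm_nonneg hL hH)
  exact le_add_of_nonneg_right (Finset.sum_nonneg fun k _ => hw.quadForm_nonneg _)

/-- The feedback of one solution, charged with the other's terminal matrix, has costs tending to the
first value but never below the second. -/
lemma IsStabilizingSolution.unique {P' : Matrix (Fin n) (Fin n) ℝ}
    (hP : p.IsStabilizingSolution P) (hP' : p.IsStabilizingSolution P') (hL : L.IsSymm)
    (hH : (p.rotatedH L).PosDef) : P = P' := by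
  have key : ∀ {P₁ P₂ : Matrix (Fin n) (Fin n) ℝ}, p.IsStabilizingSolution P₁ →
      p.IsStabilizingSolution P₂ → ∀ x, quadForm P₂ x ≤ quadForm P₁ x := by
    intro P₁ P₂ h₁ h₂ x
    exact ge_of_tendsto' (h₁.tendsto_horizonCost P₂ x) fun N =>
      h₂.quadForm_le_horizonCost hL hH x _ N
  exact hP.1.symm.ext_quadForm hP'.1.symm fun x => le_antisymm (key hP' hP x) (key hP hP' x)

/-- A smaller liminf would bound the cost along a subsequence, forcing the state to 0; the costs
would then differ by a null sequence from those with terminal matrix `P`, which never fall below the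
claimed value. -/
lemma IsStabilizingSolution.quadForm_le_liminf (hP : p.IsStabilizingSolution P) (hL : L.IsSymm)
    (hH : (p.rotatedH L).PosDef) {Pa : Matrix (Fin n) (Fin n) ℝ}
    (hPa : p.IsAntistabilizingSolution Pa) {E : Matrix (Fin n) (Fin n) ℝ} (hE : E.PosDef)
    (x₀ : Fin n → ℝ) (u : ℕ → Fin m → ℝ) :
    (quadForm P x₀ : EReal)
      ≤ liminf (fun N : ℕ => (p.horizonCost (Pa + E) x₀ u N : EReal)) atTop := by
  by_contra! hlt
  have hfreq : ∃ᶠ N in atTop, p.horizonCost (Pa + E) x₀ u N ≤ quadForm P x₀ :=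
    (frequently_lt_of_liminf_lt (by isBoundedDefault) hlt).mono fun N hN =>
      (EReal.coe_lt_coe_iff.mp hN).le
  have hx := tendsto_quadForm_state (Pa + E - P) (hPa.tendsto_state hL hH hE hfreq)
  have h1 := hx.const_add (quadForm P x₀)
  rw [add_zero] at h1
  have h2 : Tendsto (fun N => ((quadForm P x₀ + quadForm (Pa + E - P) (p.state x₀ u N) : ℝ)
      : EReal)) atTop (𝓝 (quadForm P x₀ : EReal)) :=
    (continuous_coe_real_ereal.tendsto _).comp h1
  refine hlt.not_ge ?_
  rw [← h2.liminf_eq]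
  refine liminf_le_liminf (Eventually.of_forall fun N => ?_)
  rw [horizonCost_eq_add_quadForm (P := P) (Pa + E)]
  exact EReal.coe_le_coe_iff.mpr
    (add_le_add_left (hP.quadForm_le_horizonCost hL hH x₀ u N) _)

lemma IsStabilizingSolution.isOptimalValue (hP : p.IsStabilizingSolution P) (hL : L.IsSymm)
    (hH : (p.rotatedH L).PosDef) {Pa : Matrix (Fin n) (Fin n) ℝ}
    (hPa : p.IsAntistabilizingSolution Pa) {E : Matrix (Fin n) (Fin n) ℝ} (hE : E.PosDef)
    (x₀ : Fin n → ℝ) : p.IsOptimalValue (Pa + E) x₀ (quadForm P x₀ : EReal) := by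
  refine ⟨⟨p.feedbackInput P x₀,
    (continuous_coe_real_ereal.tendsto _).comp (hP.tendsto_horizonCost (Pa + E) x₀)⟩, ?_⟩
  rintro c ⟨u, hu⟩
  rw [← Tendsto.liminf_eq hu]
  exact hP.quadForm_le_liminf hL hH hPa hE x₀ u

lemma IsStabilizingSolution.isOptimalInput_iff (hP : p.IsStabilizingSolution P) (hL : L.IsSymm)
    (hH : (p.rotatedH L).PosDef) {Pa : Matrix (Fin n) (Fin n) ℝ}
    (hPa : p.IsAntistabilizingSolution Pa) {E : Matrix (Fin n) (Fin n) ℝ} (hE : E.PosDef)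
    (x₀ : Fin n → ℝ) (u : ℕ → Fin m → ℝ) :
    p.IsOptimalInput (Pa + E) x₀ u ↔ ∀ k, u k = -(p.gain P *ᵥ p.state x₀ u k) := by
  have hopt := hP.isOptimalValue hL hH hPa hE x₀
  constructor
  · rintro ⟨c, hc, hcopt⟩ k
    obtain rfl := hcopt.unique hopt
    have hc' : Tendsto (p.horizonCost (Pa + E) x₀ u) atTop (𝓝 (quadForm P x₀)) :=
      EReal.tendsto_coe.mp hc
    have hfreq : ∃ᶠ N in atTop, p.horizonCost (Pa + E) x₀ u N ≤ quadForm P x₀ + 1 :=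
      ((hc'.eventually_lt_const (lt_add_one _)).mono fun N hN => hN.le).frequently
    have hx := tendsto_quadForm_state (Pa + E - P) (hPa.tendsto_state hL hH hE hfreq)
    have h1 := (hc'.sub hx).sub_const (quadForm P x₀)
    rw [sub_zero, sub_self] at h1
    have hw := inputWeight_posDef hL hH hP.1.symm (hP.quadForm_nonneg hL hH)
    -- The sum of squares tends to 0 and dominates each of its terms once `N > k`.
    have h2 : quadForm (p.inputWeight P) (u k + p.gain P *ᵥ p.state x₀ u k) ≤ 0 := by
      refine ge_of_tendsto h1 ((eventually_gt_atTop k).mono fun N hN => ?_)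
      rw [horizonCost_eq_add_quadForm (P := P), hP.1.horizonCost_eq, add_sub_cancel_right,
        add_sub_cancel_left]
      exact Finset.single_le_sum (f := fun k =>
        quadForm (p.inputWeight P) (u k + p.gain P *ᵥ p.state x₀ u k))
        (fun j _ => hw.quadForm_nonneg _) (Finset.mem_range.mpr hN)
    by_contra hne
    exact h2.not_gt (hw.quadForm_pos fun h => hne (eq_neg_of_add_eq_zero_left h))
  · intro hu
    obtain rfl := eq_feedbackInput hu
    exact ⟨_, (continuous_coe_real_ereal.tendsto _).comp (hP.tendsto_horizonCost (Pa + E) x₀),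
      hopt⟩

end LQProblem

end

theorem mainTheorem3 {n m : ℕ} (p : LQProblem n m)
    (hstab : p.IsStabilizable)
    (hdiss : p.IsStrictlyPreDissipative)
    (Pa : Matrix (Fin n) (Fin n) ℝ) (hPa : p.IsAntistabilizingSolution Pa)
    (E : Matrix (Fin n) (Fin n) ℝ) (hE : E.PosDef) :
    ∃ Ps : Matrix (Fin n) (Fin n) ℝ,
      p.IsStabilizingSolution Ps ∧
      (∀ P : Matrix (Fin n) (Fin n) ℝ, p.IsStabilizingSolution P → P = Ps) ∧
      (∀ x₀ : Fin n → ℝ,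
        p.IsOptimalValue (Pa + E) x₀ ((x₀ ⬝ᵥ (Ps *ᵥ x₀) : ℝ) : EReal) ∧
        (∀ u : ℕ → Fin m → ℝ,
          p.IsOptimalInput (Pa + E) x₀ u ↔ ∀ k : ℕ, u k = -(p.gain Ps *ᵥ p.state x₀ u k)) ∧
        (∀ u : ℕ → Fin m → ℝ,
          ((x₀ ⬝ᵥ (Ps *ᵥ x₀) : ℝ) : EReal) ≤
            liminf (fun N : ℕ => (p.horizonCost (Pa + E) x₀ u N : EReal)) atTop)) ∧
      IsAsymptoticallyStableEquilibrium
        (fun x : Fin n → ℝ => p.A *ᵥ x + p.B *ᵥ (-(p.gain Ps *ᵥ x))) 0 := by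
  obtain ⟨L, hL, hH⟩ := hdiss
  obtain ⟨Ps, hPs⟩ := LQProblem.exists_isStabilizingSolution hstab hL hH
  refine ⟨Ps, hPs, fun P hP => hP.unique hPs hL hH, fun x₀ =>
    ⟨hPs.isOptimalValue hL hH hPa hE x₀, hPs.isOptimalInput_iff hL hH hPa hE x₀,
      hPs.quadForm_le_liminf hL hH hPa hE x₀⟩, ?_⟩
  exact hPs.2.isAsymptoticallyStableEquilibrium fun x => p.mulVec_add_mulVec_neg Ps x
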